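/- Let $\mathbb{F}_q$ be a finite field with $q\ge 3$ elements and let $L$ be a finite-dimensional Lie algebra over $\mathbb{F}_q$. For $x\in L$ let the breadth of $x$ be the codimension in $L$ of the centralizer $C_L(x)=\{y\in L : [x,y]=0\}$. Let $Z(L)$ be the center of $L$, let $\gamma_1(L)=L$ and $\gamma_{i+1}(L)=[L,\gamma_i(L)]$ for $i\ge 1$. Let $m\ge 1$ be an integer. Suppose that (i) $L$ is 3-step nilpotent, i.e. nilpotent of nilpotency class exactly $3$; (ii) $L$ is stem, i.e. $Z(L)\subseteq [L,L]$; (iii) $L$ has breadth type $(0,2m)$, i.e. the set of breadths of elements of $L$ is exactly $\{0,2m\}$. Then $Z(L)=\gamma_3(L)$ and $\dim_{\mathbb{F}_q} Z(L)=2m$. -/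

import Mathlib

/-- The centralizer `C_L(x) = {y ∈ L | ⁅x, y⁆ = 0}` of an element `x`, as a subspace of `L`. -/
def lieCentralizer (F : Type*) {L : Type*} [Field F] [LieRing L] [LieAlgebra F L] (x : L) :
    Submodule F L :=
  LinearMap.ker (LieAlgebra.ad F L x)

/-- The breadth of `x`: the codimension of the centralizer of `x` in `L`. -/
noncomputable def breadth (F : Type*) {L : Type*} [Field F] [LieRing L] [LieAlgebra F L]
    (x : L) : ℕ :=
  Module.finrank F (L ⧸ lieCentralizer F x)

/-- `L` has breadth type `(s₀, s₁, …, sᵣ)`: the entries of the list `s` are distinct, in increasing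
order, and are exactly the breadths of the elements of `L`. -/
def HasBreadthType (F L : Type*) [Field F] [LieRing L] [LieAlgebra F L] (s : List ℕ) : Prop :=
  s.Pairwise (· < ·) ∧ ∀ n : ℕ, n ∈ s ↔ ∃ x : L, breadth F x = n

/-- `L` is stem: its center is contained in its derived subalgebra `⁅L, L⁆`. -/
def IsStem (F L : Type*) [Field F] [LieRing L] [LieAlgebra F L] : Prop :=
  LieAlgebra.center F L ≤ ⁅(⊤ : LieIdeal F L), (⊤ : LieIdeal F L)⁆

/-- `L` is `c`-step nilpotent: it is nilpotent, of nilpotency class exactly `c`. -/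
def IsStepNilpotent (L : Type*) [LieRing L] (c : ℕ) : Prop :=
  LieRing.IsNilpotent L ∧ LieModule.nilpotencyLength L L = c

/-- The terms of the lower central series in the indexing `γ₁(L) = L`, `γᵢ₊₁(L) = ⁅L, γᵢ(L)⁆`;
the value at the index `0`, where there is no such term, is `L`. -/
def lieGamma (F L : Type*) [Field F] [LieRing L] [LieAlgebra F L] (i : ℕ) : LieIdeal F L :=
  LieModule.lowerCentralSeries F L L (i - 1)

/-! Write Z for the center, B for the second center, G = [L,L], T = γ₃, C_x = {d : [x,d] ∈ Z}, and n
for the breadth of noncentral elements. Let c = [x,y] ∉ Z. For d ∈ C_x the Jacobi identity gives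
[c,d] = [x,[y,d]], so [c,C_x] ⊆ [x,G] ⊆ [x,C_x]. As c and x have equal breadth, dimensions force
[x,G] = [x,C_x] (`lieImage_derived_eq_and_lieCentralizer_lie_le`).

This leads to C_L(c) = B = C_x ∩ C_y, C_x + C_y = L and dim [x,G] = n/2, whence [c,L] = [x,G] ⊕
[y,G] = T has dimension n.

Finally, every central commutator lies in T, and G ⊆ [x,L] + T (`derived_le_lieImage_sup`). By
stemness a central element lies in G, so modulo T it is a central commutator [x,t]; hence Z = T. -/

theorem finrank_map_add_finrank_inf_ker {F V W : Type*} [Field F] [AddCommGroup V] [Module F V]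
    [AddCommGroup W] [Module F W] [Module.Finite F V] (f : V →ₗ[F] W) (P : Submodule F V) :
    Module.finrank F (P.map f) + Module.finrank F (P ⊓ LinearMap.ker f : Submodule F V) =
      Module.finrank F P := by
  have h := LinearMap.finrank_range_add_finrank_ker (f.domRestrict P)
  rw [LinearMap.range_domRestrict, LinearMap.ker_domRestrict] at h
  rw [← h, ← Submodule.map_comap_subtype, Submodule.finrank_map_subtype_eq]

/-- The subspace of those `y` with `⁅x, y⁆ ∈ Z`. -/
def centralizerMod {F L : Type*} [Field F] [LieRing L] [LieAlgebra F L] (Z : Submodule F L)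
    (x : L) : Submodule F L :=
  Z.comap (LieAlgebra.ad F L x : L →ₗ[F] L)

/-- The subspace of those `x` with `⁅x, L⁆ ⊆ Z`; for `Z` the center, this is the second center. -/
def centerMod {F L : Type*} [Field F] [LieRing L] [LieAlgebra F L] (Z : Submodule F L) :
    Submodule F L :=
  ⨅ y, centralizerMod Z y

/-- The image of the subspace `P` under bracketing with `x`. -/
def lieImage {F L : Type*} [Field F] [LieRing L] [LieAlgebra F L] (x : L) (P : Submodule F L) :
    Submodule F L :=
  P.map (LieAlgebra.ad F L x : L →ₗ[F] L)

/-- `Z` is the center and `G` the derived subalgebra of a Lie algebra of nilpotency class at most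
`3`, the center lies in the derived subalgebra, and all noncentral elements have breadth `n`. -/
structure HasConstantBreadth {F L : Type*} [Field F] [LieRing L] [LieAlgebra F L]
    (Z G : Submodule F L) (n : ℕ) : Prop where
  mem_center : ∀ x : L, x ∈ Z ↔ ∀ y : L, ⁅x, y⁆ = 0
  lie_mem : ∀ x y : L, ⁅x, y⁆ ∈ G
  center_le : Z ≤ G
  derived_le : ∀ P : Submodule F L, (∀ x y : L, ⁅x, y⁆ ∈ P) → G ≤ P
  lie_derived : ∀ a ∈ G, ∀ y : L, ⁅a, y⁆ ∈ Z
  finrank_lieImage : ∀ x, x ∉ Z → Module.finrank F (lieImage (F := F) x ⊤) = n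

section

variable {F L : Type*} [Field F] [LieRing L] [LieAlgebra F L] {Z : Submodule F L}

/-! ### Centralizers and bracket images -/

theorem mem_lieCentralizer {x y : L} : y ∈ lieCentralizer F x ↔ ⁅x, y⁆ = 0 := by
  simp [lieCentralizer]

theorem mem_centralizerMod {x y : L} : y ∈ centralizerMod Z x ↔ ⁅x, y⁆ ∈ Z := by
  simp [centralizerMod]

theorem mem_centralizerMod_comm {x y : L} : y ∈ centralizerMod Z x ↔ x ∈ centralizerMod Z y := by
  rw [mem_centralizerMod, mem_centralizerMod, ← lie_skew, neg_mem_iff]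

theorem mem_centerMod {x : L} : x ∈ centerMod Z ↔ ∀ y, ⁅x, y⁆ ∈ Z := by
  simp only [centerMod, Submodule.mem_iInf]
  exact forall_congr' fun y => by rw [mem_centralizerMod_comm, mem_centralizerMod]

theorem centerMod_le_centralizerMod (x : L) : centerMod Z ≤ centralizerMod Z x :=
  iInf_le _ x

theorem lie_mem_lieImage {x y : L} {P : Submodule F L} (hy : y ∈ P) : ⁅x, y⁆ ∈ lieImage x P :=
  ⟨y, hy, by simp⟩

theorem mem_lieImage {x z : L} {P : Submodule F L} :
    z ∈ lieImage x P ↔ ∃ y ∈ P, ⁅x, y⁆ = z := by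
  simp [lieImage]

theorem lieImage_le_iff {x : L} {P Q : Submodule F L} :
    lieImage x P ≤ Q ↔ ∀ y ∈ P, ⁅x, y⁆ ∈ Q := by
  constructor
  · exact fun h y hy => h (lie_mem_lieImage hy)
  · intro h z hz
    obtain ⟨y, hy, rfl⟩ := mem_lieImage.1 hz
    exact h y hy

theorem lieImage_mono {x : L} {P Q : Submodule F L} (h : P ≤ Q) : lieImage x P ≤ lieImage x Q :=
  Submodule.map_mono h

theorem finrank_lieImage_add [Module.Finite F L] (x : L) (P : Submodule F L) :
    Module.finrank F (lieImage x P) + Module.finrank F (P ⊓ lieCentralizer F x : Submodule F L) =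
      Module.finrank F P :=
  finrank_map_add_finrank_inf_ker _ _

theorem lieCentralizer_le_centralizerMod (x : L) : lieCentralizer F x ≤ centralizerMod Z x := by
  intro y hy
  rw [mem_centralizerMod, mem_lieCentralizer.1 hy]
  exact zero_mem _

namespace HasConstantBreadth

variable {G : Submodule F L} {n : ℕ}

/-! ### Center, second center and derived subalgebra -/

theorem lieCentralizer_derived (h : HasConstantBreadth Z G n) {a : L} (ha : a ∈ G) :
    centerMod Z ≤ lieCentralizer F a := by
  intro b hb
  rw [mem_centerMod] at hb
  suffices H : G ≤ lieCentralizer F b by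
    rw [mem_lieCentralizer, ← lie_skew, mem_lieCentralizer.1 (H ha), neg_zero]
  refine h.derived_le _ fun x y => ?_
  rw [mem_lieCentralizer, leibniz_lie, (h.mem_center _).1 (hb x), ← lie_skew,
    (h.mem_center _).1 (hb y), neg_zero, add_zero]

theorem derived_le_centerMod (h : HasConstantBreadth Z G n) : G ≤ centerMod Z :=
  fun a ha => mem_centerMod.2 (h.lie_derived a ha)

theorem lie_derived_derived (h : HasConstantBreadth Z G n) {a b : L} (ha : a ∈ G) (hb : b ∈ G) :
    ⁅a, b⁆ = 0 :=
  mem_lieCentralizer.1 (h.lieCentralizer_derived (F := F) ha (h.derived_le_centerMod hb))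

theorem derived_le_centralizerMod (h : HasConstantBreadth Z G n) (x : L) :
    G ≤ centralizerMod Z x :=
  h.derived_le_centerMod.trans (centerMod_le_centralizerMod x)

theorem center_le_lieCentralizer (h : HasConstantBreadth Z G n) (x : L) :
    Z ≤ lieCentralizer F x := by
  intro z hz
  rw [mem_lieCentralizer, ← lie_skew, (h.mem_center z).1 hz, neg_zero]

theorem not_mem_center_of_not_mem_centerMod (h : HasConstantBreadth Z G n) {x : L}
    (hx : x ∉ centerMod Z) : x ∉ Z :=
  fun hz => hx (h.derived_le_centerMod (h.center_le hz))

theorem finrank_lieCentralizer [Module.Finite F L] (h : HasConstantBreadth Z G n) {x : L}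
    (hx : x ∉ Z) :
    n + Module.finrank F (lieCentralizer F x) = Module.finrank F L := by
  have := finrank_lieImage_add (F := F) x ⊤
  rwa [h.finrank_lieImage x hx, top_inf_eq, finrank_top] at this

theorem finrank_lieImage_centralizerMod [Module.Finite F L] (h : HasConstantBreadth Z G n) {x : L}
    (hx : x ∉ Z) :
    Module.finrank F (lieImage x (centralizerMod Z x)) + Module.finrank F L =
      n + Module.finrank F (centralizerMod Z x) := by
  have h1 := finrank_lieImage_add x (centralizerMod Z x)
  rw [inf_eq_right.2 (lieCentralizer_le_centralizerMod x)] at h1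
  have h2 := h.finrank_lieCentralizer hx
  omega

/-! ### Centralizers modulo the center -/

theorem lieImage_lie_centralizerMod_le (h : HasConstantBreadth Z G n) (x y : L) :
    lieImage ⁅x, y⁆ (centralizerMod Z x) ≤ lieImage x G := by
  refine lieImage_le_iff.2 fun d hd => ?_
  have h1 : ⁅⁅x, y⁆, d⁆ = ⁅x, ⁅y, d⁆⁆ := by
    rw [lie_lie, sub_eq_self, ← lie_skew, (h.mem_center _).1 (mem_centralizerMod.1 hd), neg_zero]
  rw [h1]
  exact lie_mem_lieImage (h.lie_mem _ _)

/-- Since `⁅x, y⁆` and `x` have the same breadth, [[x,y],C_x] has dimension at least that of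
[x,C_x], yet it lies in [x,G] ⊆ [x,C_x]. All these inequalities are equalities. -/
theorem lieImage_derived_eq_and_lieCentralizer_lie_le [Module.Finite F L]
    (h : HasConstantBreadth Z G n) {x y : L} (hxy : ⁅x, y⁆ ∉ Z) :
    lieImage x G = lieImage x (centralizerMod Z x) ∧
      lieCentralizer F ⁅x, y⁆ ≤ centralizerMod Z x := by
  have hx : x ∉ Z := fun hx => hxy (by rw [(h.mem_center x).1 hx]; exact zero_mem _)
  have h1 := finrank_lieImage_add ⁅x, y⁆ (centralizerMod Z x)
  have h2 := h.finrank_lieImage_centralizerMod hx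
  have h3 := h.finrank_lieCentralizer hxy
  have h4 := Submodule.finrank_mono (h.lieImage_lie_centralizerMod_le x y)
  have h5 := lieImage_mono (x := x) (h.derived_le_centralizerMod x)
  have h6 := Submodule.finrank_mono h5
  have h7 := Submodule.finrank_mono
    (inf_le_right : centralizerMod Z x ⊓ lieCentralizer F ⁅x, y⁆ ≤ _)
  refine ⟨Submodule.eq_of_le_of_finrank_le h5 (by omega), ?_⟩
  rw [← inf_eq_right]
  exact Submodule.eq_of_le_of_finrank_le inf_le_right (by omega)

theorem lieImage_derived_eq [Module.Finite F L] (h : HasConstantBreadth Z G n) {x : L}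
    (hx : x ∉ centerMod Z) : lieImage x G = lieImage x (centralizerMod Z x) := by
  rw [mem_centerMod] at hx
  push Not at hx
  obtain ⟨y, hy⟩ := hx
  exact (h.lieImage_derived_eq_and_lieCentralizer_lie_le hy).1

theorem mem_lieImage_derived [Module.Finite F L] (h : HasConstantBreadth Z G n) {x y : L}
    (hx : x ∉ centerMod Z) (hxy : ⁅x, y⁆ ∈ Z) : ⁅x, y⁆ ∈ lieImage x G := by
  rw [h.lieImage_derived_eq hx]
  exact lie_mem_lieImage (mem_centralizerMod.2 hxy)

/-- Replacing `x` by `x + u` does not enlarge [x,G], because G is abelian; subtracting `⁅x, z⁆` from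
`⁅x + u, z⁆` leaves `⁅u, z⁆`. -/
theorem lie_derived_mem_lieImage [Module.Finite F L] (h : HasConstantBreadth Z G n) {x u z : L}
    (hx : x ∉ centerMod Z) (hu : u ∈ G) (hz : z ∈ centralizerMod Z x) :
    ⁅u, z⁆ ∈ lieImage x G := by
  have hxu : x + u ∉ centerMod Z := by
    rwa [Submodule.add_mem_iff_left _ (h.derived_le_centerMod hu)]
  rw [mem_centralizerMod] at hz
  have h1 : ⁅x + u, z⁆ ∈ lieImage (x + u) G :=
    h.mem_lieImage_derived hxu (by rw [add_lie]; exact add_mem hz (h.lie_derived u hu z))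
  have h2 : lieImage (x + u) G ≤ lieImage x G := by
    refine lieImage_le_iff.2 fun a ha => ?_
    rw [add_lie, h.lie_derived_derived hu ha, add_zero]
    exact lie_mem_lieImage ha
  have h3 := sub_mem (h2 h1) (h.mem_lieImage_derived hx hz)
  rwa [add_lie, add_sub_cancel_left] at h3

theorem lieImage_derived_le [Module.Finite F L] (h : HasConstantBreadth Z G n) {x y : L}
    (hx : x ∉ centerMod Z) (hy : y ∈ centralizerMod Z x) : lieImage y G ≤ lieImage x G := by
  refine lieImage_le_iff.2 fun a ha => ?_
  rw [← lie_skew]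
  exact neg_mem (h.lie_derived_mem_lieImage hx ha hy)

theorem not_mem_centerMod_left {x y : L} (hxy : ⁅x, y⁆ ∉ Z) : x ∉ centerMod Z :=
  fun hx => hxy (mem_centerMod.1 hx y)

theorem lie_not_mem_comm {x y : L} (hxy : ⁅x, y⁆ ∉ Z) : ⁅y, x⁆ ∉ Z := by
  rwa [← lie_skew, neg_mem_iff]

theorem lieImage_lie_le (x y : L) (h : HasConstantBreadth Z G n) :
    lieImage ⁅x, y⁆ ⊤ ≤ lieImage x G ⊔ lieImage y G := by
  refine lieImage_le_iff.2 fun z _ => ?_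
  rw [lie_lie]
  exact sub_mem (Submodule.mem_sup_left (lie_mem_lieImage (h.lie_mem _ _)))
    (Submodule.mem_sup_right (lie_mem_lieImage (h.lie_mem _ _)))

/-- An element z ∉ B centralizing `⁅x, y⁆` would lie in C_x ∩ C_y, giving [y,G] ⊆ [z,G] ⊆ [x,G].
Then [x,G] contains [[x,y],L], of dimension n, which forces C_x = L. -/
theorem lieCentralizer_lie_eq [Module.Finite F L] (h : HasConstantBreadth Z G n) {x y : L}
    (hxy : ⁅x, y⁆ ∉ Z) : lieCentralizer F ⁅x, y⁆ = centerMod Z := by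
  have hyx := lie_not_mem_comm hxy
  have hx := not_mem_centerMod_left hxy
  have hy := not_mem_centerMod_left hyx
  refine le_antisymm (fun z hz => ?_) (h.lieCentralizer_derived (h.lie_mem x y))
  by_contra hzB
  have hzx := (h.lieImage_derived_eq_and_lieCentralizer_lie_le hxy).2 hz
  have hzy : z ∈ centralizerMod Z y := by
    refine (h.lieImage_derived_eq_and_lieCentralizer_lie_le hyx).2 ?_
    rw [mem_lieCentralizer] at hz ⊢
    rw [← lie_skew y x, neg_lie, hz, neg_zero]
  have hyx' : lieImage y G ≤ lieImage x G :=
    (h.lieImage_derived_le hzB (mem_centralizerMod_comm.1 hzy)).trans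
      (h.lieImage_derived_le hx hzx)
  have h1 := Submodule.finrank_mono ((h.lieImage_lie_le x y).trans (sup_le le_rfl hyx'))
  rw [h.finrank_lieImage _ hxy, h.lieImage_derived_eq hx] at h1
  have h2 := h.finrank_lieImage_centralizerMod (h.not_mem_center_of_not_mem_centerMod hx)
  have h3 : centralizerMod Z x = ⊤ :=
    Submodule.eq_of_le_of_finrank_le le_top (by rw [finrank_top]; omega)
  exact hxy (mem_centralizerMod.1 (h3 ▸ Submodule.mem_top))

theorem centralizerMod_inf_le [Module.Finite F L] (h : HasConstantBreadth Z G n) {x y : L}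
    (hxy : ⁅x, y⁆ ∉ Z) : centralizerMod Z x ⊓ centralizerMod Z y = centerMod Z := by
  refine le_antisymm ?_
    (le_inf (centerMod_le_centralizerMod x) (centerMod_le_centralizerMod y))
  rw [← h.lieCentralizer_lie_eq hxy]
  rintro z ⟨hzx, hzy⟩
  rw [mem_lieCentralizer, lie_lie, ← lie_skew x, ← lie_skew y ⁅x, z⁆,
    (h.mem_center _).1 (mem_centralizerMod.1 hzx), (h.mem_center _).1 (mem_centralizerMod.1 hzy),
    sub_self]

/-- B = C_L([v₁,v₂]) has codimension n, so it is the whole centralizer of any noncentral a ∈ G. -/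
theorem derived_inf_lieCentralizer [Module.Finite F L] (h : HasConstantBreadth Z G n) {v₁ v₂ x : L}
    (hv : ⁅v₁, v₂⁆ ∉ Z) (hx : x ∉ centerMod Z) : G ⊓ lieCentralizer F x = Z := by
  refine le_antisymm ?_ (le_inf h.center_le (h.center_le_lieCentralizer x))
  rintro a ⟨haG, hax⟩
  by_contra haZ
  have h1 := h.finrank_lieCentralizer haZ
  have h2 := h.finrank_lieCentralizer hv
  rw [h.lieCentralizer_lie_eq hv] at h2
  have h3 : centerMod Z = lieCentralizer F a :=
    Submodule.eq_of_le_of_finrank_le (h.lieCentralizer_derived haG) (by omega)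
  refine hx (h3 ▸ mem_lieCentralizer.2 ?_)
  rw [← lie_skew, mem_lieCentralizer.1 hax, neg_zero]

/-- Every [t,G] has the same dimension k = dim G - dim Z. The inclusion [[x,y],L] ⊆ [x,G] + [y,G]
gives n ≤ 2k. Conversely C_x and C_y have codimension n - k and meet in B, of codimension n, so n ≤
2(n - k), with equality only if they span L. -/
theorem finrank_lieImage_derived [Module.Finite F L] (h : HasConstantBreadth Z G n) {x y t : L}
    (hxy : ⁅x, y⁆ ∉ Z) (ht : t ∉ centerMod Z) :
    2 * Module.finrank F (lieImage t G) = n ∧ centralizerMod Z x ⊔ centralizerMod Z y = ⊤ := by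
  have key : ∀ t, t ∉ centerMod Z →
      Module.finrank F (lieImage t G) + Module.finrank F Z = Module.finrank F G := by
    intro t ht
    have h1 := finrank_lieImage_add t G
    rwa [h.derived_inf_lieCentralizer hxy ht] at h1
  have hx := not_mem_centerMod_left hxy
  have hy := not_mem_centerMod_left (lie_not_mem_comm hxy)
  have kt := key t ht
  have kx := key x hx
  have ky := key y hy
  have dx := h.finrank_lieImage_centralizerMod (h.not_mem_center_of_not_mem_centerMod hx)
  have dy := h.finrank_lieImage_centralizerMod (h.not_mem_center_of_not_mem_centerMod hy)
  rw [← h.lieImage_derived_eq hx] at dx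
  rw [← h.lieImage_derived_eq hy] at dy
  have h1 := Submodule.finrank_sup_add_finrank_inf_eq (centralizerMod Z x) (centralizerMod Z y)
  rw [h.centralizerMod_inf_le hxy] at h1
  have h2 := h.finrank_lieCentralizer hxy
  rw [h.lieCentralizer_lie_eq hxy] at h2
  have h3 := Submodule.finrank_mono (h.lieImage_lie_le x y)
  rw [h.finrank_lieImage _ hxy] at h3
  have h4 := Submodule.finrank_add_le_finrank_add_finrank (lieImage x G) (lieImage y G)
  have h5 := Submodule.finrank_le (centralizerMod Z x ⊔ centralizerMod Z y)
  refine ⟨by omega, Submodule.eq_of_le_of_finrank_le le_top (by rw [finrank_top]; omega)⟩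

theorem lie_derived_mem_lieImage_lie [Module.Finite F L] (h : HasConstantBreadth Z G n) {x y : L}
    (hxy : ⁅x, y⁆ ∉ Z) {a : L} (ha : a ∈ G) (t : L) : ⁅a, t⁆ ∈ lieImage (F := F) ⁅x, y⁆ ⊤ := by
  have hx := not_mem_centerMod_left hxy
  have hy := not_mem_centerMod_left (lie_not_mem_comm hxy)
  have h1 := (h.finrank_lieImage_derived hxy hx).1
  have h2 := (h.finrank_lieImage_derived hxy hy).1
  have h3 := Submodule.finrank_add_le_finrank_add_finrank (lieImage x G) (lieImage y G)
  have h4 : lieImage ⁅x, y⁆ ⊤ = lieImage x G ⊔ lieImage y G :=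
    Submodule.eq_of_le_of_finrank_le (h.lieImage_lie_le x y)
      (by rw [h.finrank_lieImage _ hxy]; omega)
  have ht : t ∈ centralizerMod Z x ⊔ centralizerMod Z y :=
    (h.finrank_lieImage_derived hxy hx).2 ▸ Submodule.mem_top
  obtain ⟨r, hr, s, hs, rfl⟩ := Submodule.mem_sup.1 ht
  rw [h4, lie_add]
  exact add_mem (Submodule.mem_sup_left (h.lie_derived_mem_lieImage hx ha hr))
    (Submodule.mem_sup_right (h.lie_derived_mem_lieImage hy ha hs))

/-- Here `T` plays the role of the third term of the lower central series. -/
theorem lie_mem_of_lie_mem_center [Module.Finite F L] (h : HasConstantBreadth Z G n)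
    {T : Submodule F L} (hT : ∀ a ∈ G, ∀ t : L, ⁅a, t⁆ ∈ T) {x s t : L} (hx : x ∉ centerMod Z)
    (hst : ⁅s, t⁆ ∈ Z) : ⁅s, t⁆ ∈ T := by
  have key : ∀ s, s ∉ centerMod Z → ∀ t, ⁅s, t⁆ ∈ Z → ⁅s, t⁆ ∈ T := by
    intro s hs t hst
    obtain ⟨a, ha, hat⟩ := mem_lieImage.1 (h.mem_lieImage_derived hs hst)
    rw [← hat, ← lie_skew]
    exact neg_mem (hT a ha s)
  by_cases hs : s ∈ centerMod Z
  · have h1 := key x hx s (mem_centralizerMod.1 (centerMod_le_centralizerMod x hs))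
    by_cases ht : t ∈ centerMod Z
    -- With both `s` and `t` in B, `x + t` is still outside B, so `key` applies to it.
    · have h2 := key (x + t) (by rwa [Submodule.add_mem_iff_left _ ht]) s
        (mem_centralizerMod.1 (centerMod_le_centralizerMod _ hs))
      rw [add_lie, Submodule.add_mem_iff_right _ h1] at h2
      rwa [← lie_skew, neg_mem_iff]
    · rw [← lie_skew, neg_mem_iff]
      exact key t ht s (mem_centralizerMod.1 (centerMod_le_centralizerMod _ hs))
  · exact key s hs t hst

/-- By Jacobi `⁅s, t⁆` commutes with `x`, so it lies in G ∩ C_L(x) = Z. -/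
theorem lie_mem_of_mem_centralizerMod [Module.Finite F L] (h : HasConstantBreadth Z G n)
    {T : Submodule F L} (hT : ∀ a ∈ G, ∀ t : L, ⁅a, t⁆ ∈ T) {x y s t : L} (hxy : ⁅x, y⁆ ∉ Z)
    (hs : s ∈ centralizerMod Z x) (ht : t ∈ centralizerMod Z x) : ⁅s, t⁆ ∈ T := by
  have hx := not_mem_centerMod_left hxy
  refine h.lie_mem_of_lie_mem_center hT hx ?_
  rw [← h.derived_inf_lieCentralizer hxy hx]
  refine ⟨h.lie_mem _ _, ?_⟩
  rw [SetLike.mem_coe, mem_lieCentralizer, leibniz_lie,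
    (h.mem_center _).1 (mem_centralizerMod.1 hs), ← lie_skew,
    (h.mem_center _).1 (mem_centralizerMod.1 ht), neg_zero, add_zero]

/-! ### Commutators modulo T -/

/-- [w,L] ∩ T = [w,G] has dimension n/2 for every w ∉ B. That the result is independent of `w` later
turns an inclusion into an equality. -/
theorem finrank_lieImage_sup [Module.Finite F L] (h : HasConstantBreadth Z G n)
    {T : Submodule F L} (hT : ∀ a ∈ G, ∀ t : L, ⁅a, t⁆ ∈ T) (hTZ : T ≤ Z) {x y w : L}
    (hxy : ⁅x, y⁆ ∉ Z) (hw : w ∉ centerMod Z) :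
    2 * Module.finrank F (lieImage w ⊤ ⊔ T : Submodule F L) = n + 2 * Module.finrank F T := by
  have h1 := Submodule.finrank_sup_add_finrank_inf_eq (lieImage w ⊤) T
  have h2 : lieImage w ⊤ ⊓ T = lieImage w G := by
    refine le_antisymm ?_ (le_inf (lieImage_mono le_top) (lieImage_le_iff.2 fun a ha => ?_))
    · rintro z ⟨hz, hzT⟩
      obtain ⟨t, -, rfl⟩ := mem_lieImage.1 hz
      exact h.mem_lieImage_derived hw (hTZ hzT)
    · rw [← lie_skew, neg_mem_iff]
      exact hT a ha w
  rw [h2, h.finrank_lieImage w (h.not_mem_center_of_not_mem_centerMod hw)] at h1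
  have h3 := (h.finrank_lieImage_derived hxy hw).1
  omega

/-- C_x and C_y commute with themselves modulo T, so [s,p + q] ≡ [s,q] ≡ [s + t,q] for p ∈ C_x, q ∈
C_y. -/
theorem lieImage_sup_eq [Module.Finite F L] (h : HasConstantBreadth Z G n)
    {T : Submodule F L} (hT : ∀ a ∈ G, ∀ t : L, ⁅a, t⁆ ∈ T) (hTZ : T ≤ Z) {x y s t : L}
    (hxy : ⁅x, y⁆ ∉ Z) (hs : s ∈ centralizerMod Z x) (ht : t ∈ centralizerMod Z y)
    (hsB : s ∉ centerMod Z) :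
    lieImage s ⊤ ⊔ T = lieImage (s + t) ⊤ ⊔ T := by
  have hx := not_mem_centerMod_left hxy
  have hyx := lie_not_mem_comm hxy
  have hstB : s + t ∉ centerMod Z := by
    intro hst
    refine hsB ?_
    rw [← h.centralizerMod_inf_le hxy]
    refine ⟨hs, ?_⟩
    have := sub_mem (centerMod_le_centralizerMod y hst) ht
    rwa [add_sub_cancel_right] at this
  refine Submodule.eq_of_le_of_finrank_le (sup_le (lieImage_le_iff.2 fun l _ => ?_) le_sup_right) ?_
  · have hl : l ∈ centralizerMod Z x ⊔ centralizerMod Z y :=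
      (h.finrank_lieImage_derived hxy hx).2 ▸ Submodule.mem_top
    obtain ⟨p, hp, q, hq, rfl⟩ := Submodule.mem_sup.1 hl
    have h1 : ⁅s, p + q⁆ = ⁅s + t, q⁆ + (⁅s, p⁆ - ⁅t, q⁆) := by
      rw [lie_add, add_lie]; abel
    rw [h1]
    exact add_mem (Submodule.mem_sup_left (lie_mem_lieImage Submodule.mem_top))
      (Submodule.mem_sup_right (sub_mem (h.lie_mem_of_mem_centralizerMod hT hxy hs hp)
        (h.lie_mem_of_mem_centralizerMod hT hyx ht hq)))
  · have h1 := h.finrank_lieImage_sup hT hTZ hxy hsB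
    have h2 := h.finrank_lieImage_sup hT hTZ hxy hstB
    omega

/-- By the symmetry of `lieImage_sup_eq`, [s,L] + T = [s + t,L] + T = [t,L] + T for all s ∈ C_x and
t ∈ C_y outside B; since C_x + C_y = L, this one subspace contains every commutator. -/
theorem derived_le_lieImage_sup [Module.Finite F L] (h : HasConstantBreadth Z G n)
    {T : Submodule F L} (hT : ∀ a ∈ G, ∀ t : L, ⁅a, t⁆ ∈ T) (hTZ : T ≤ Z) {x y : L}
    (hxy : ⁅x, y⁆ ∉ Z) : G ≤ lieImage x ⊤ ⊔ T := by
  have hx := not_mem_centerMod_left hxy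
  have hyx := lie_not_mem_comm hxy
  have hy := not_mem_centerMod_left hyx
  have self_mem : ∀ u : L, u ∈ centralizerMod Z u := fun u => by
    rw [mem_centralizerMod, lie_self]; exact zero_mem _
  have key : ∀ s ∈ centralizerMod Z x, s ∉ centerMod Z → ∀ t ∈ centralizerMod Z y,
      t ∉ centerMod Z → lieImage s ⊤ ⊔ T = lieImage t ⊤ ⊔ T := by
    intro s hs hsB t ht htB
    rw [h.lieImage_sup_eq hT hTZ hxy hs ht hsB, h.lieImage_sup_eq hT hTZ hyx ht hs htB,
      add_comm]
  refine h.derived_le _ fun l k => ?_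
  have hl : l ∈ centralizerMod Z x ⊔ centralizerMod Z y :=
    (h.finrank_lieImage_derived hxy hx).2 ▸ Submodule.mem_top
  obtain ⟨s, hs, t, ht, rfl⟩ := Submodule.mem_sup.1 hl
  have hB : ∀ b ∈ centerMod Z, ⁅b, k⁆ ∈ lieImage x ⊤ ⊔ T := fun b hb =>
    Submodule.mem_sup_right (h.lie_mem_of_lie_mem_center hT hx (mem_centerMod.1 hb k))
  rw [add_lie]
  refine add_mem ?_ ?_
  · by_cases hsB : s ∈ centerMod Z
    · exact hB s hsB
    · rw [key x (self_mem x) hx y (self_mem y) hy, ← key s hs hsB y (self_mem y) hy]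
      exact Submodule.mem_sup_left (lie_mem_lieImage Submodule.mem_top)
  · by_cases htB : t ∈ centerMod Z
    · exact hB t htB
    · rw [key x (self_mem x) hx t ht htB]
      exact Submodule.mem_sup_left (lie_mem_lieImage Submodule.mem_top)

theorem center_eq_lieImage [Module.Finite F L] (h : HasConstantBreadth Z G n) {x y : L}
    (hxy : ⁅x, y⁆ ∉ Z) : Z = lieImage ⁅x, y⁆ ⊤ := by
  have hT : ∀ a ∈ G, ∀ t : L, ⁅a, t⁆ ∈ lieImage (F := F) ⁅x, y⁆ ⊤ := fun a ha t =>
    h.lie_derived_mem_lieImage_lie hxy ha t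
  have hTZ : lieImage ⁅x, y⁆ ⊤ ≤ Z :=
    lieImage_le_iff.2 fun t _ => h.lie_derived _ (h.lie_mem x y) t
  refine le_antisymm (fun z hz => ?_) hTZ
  obtain ⟨a, ha, b, hb, rfl⟩ :=
    Submodule.mem_sup.1 (h.derived_le_lieImage_sup hT hTZ hxy (h.center_le hz))
  obtain ⟨t, -, rfl⟩ := mem_lieImage.1 ha
  refine add_mem (h.lie_mem_of_lie_mem_center hT (not_mem_centerMod_left hxy) ?_) hb
  have := sub_mem hz (hTZ hb)
  rwa [add_sub_cancel_right] at this

end HasConstantBreadth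

/-! ### Breadth and the main theorem -/

theorem breadth_eq_finrank_lieImage [Module.Finite F L] (x : L) :
    breadth F x = Module.finrank F (lieImage (F := F) x ⊤) := by
  have h1 := finrank_lieImage_add (F := F) x ⊤
  rw [top_inf_eq, finrank_top] at h1
  have h2 := Submodule.finrank_quotient_add_finrank (lieCentralizer F x)
  rw [breadth]
  omega

theorem mem_center_iff_lie_eq_zero {x : L} :
    x ∈ (LieAlgebra.center F L).toSubmodule ↔ ∀ y : L, ⁅x, y⁆ = 0 := by
  rw [LieSubmodule.mem_toSubmodule, LieModule.mem_maxTrivSubmodule]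
  exact forall_congr' fun y => by rw [← lie_skew, neg_eq_zero]

theorem mem_center_of_breadth_eq_zero [Module.Finite F L] {x : L} (hx : breadth F x = 0) :
    x ∈ (LieAlgebra.center F L).toSubmodule := by
  rw [breadth_eq_finrank_lieImage, Submodule.finrank_eq_zero] at hx
  refine mem_center_iff_lie_eq_zero.2 fun y => ?_
  have h1 : ⁅x, y⁆ ∈ lieImage (F := F) x ⊤ := lie_mem_lieImage Submodule.mem_top
  rwa [hx, Submodule.mem_bot] at h1

end

theorem mainTheorem8 {F L : Type*} [Field F] [Finite F] (hq : 3 ≤ Nat.card F)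
    [LieRing L] [LieAlgebra F L] [Module.Finite F L] (m : ℕ)
    (hnil : IsStepNilpotent L 3) (hstem : IsStem F L)
    (hbreadth : HasBreadthType F L [0, 2 * m]) :
    LieAlgebra.center F L = lieGamma F L 3 ∧
      Module.finrank F (LieAlgebra.center F L) = 2 * m := by
  obtain ⟨-, hlen⟩ := hnil
  -- The series is indexed from 0: term 2 is γ₃, nonzero, and term 3 is γ₄ = 0.
  obtain ⟨h3, h2⟩ := (LieModule.nilpotencyLength_eq_succ_iff F L L 2).1 hlen
  set D : LieIdeal F L := ⁅(⊤ : LieIdeal F L), (⊤ : LieIdeal F L)⁆ with hD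
  have hlcs : LieModule.lowerCentralSeries F L L 2 = ⁅(⊤ : LieIdeal F L), D⁆ := by
    rw [LieModule.lowerCentralSeries_succ, LieModule.lowerCentralSeries_succ,
      LieModule.lowerCentralSeries_zero]
  have hDZ : ∀ a ∈ D, ∀ y : L, ⁅a, y⁆ ∈ LieModule.lowerCentralSeries F L L 2 := by
    intro a ha y
    rw [hlcs, ← lie_skew, neg_mem_iff]
    exact LieSubmodule.lie_mem_lie (LieSubmodule.mem_top y) ha
  have hTZ : LieModule.lowerCentralSeries F L L 2 ≤ LieAlgebra.center F L := by
    intro z hz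
    rw [LieModule.mem_maxTrivSubmodule]
    intro y
    rw [← LieSubmodule.mem_bot (R := F) (L := L), ← h3, LieModule.lowerCentralSeries_succ]
    exact LieSubmodule.lie_mem_lie (LieSubmodule.mem_top y) hz
  have H : HasConstantBreadth (LieAlgebra.center F L).toSubmodule D.toSubmodule (2 * m) := by
    refine ⟨fun x => mem_center_iff_lie_eq_zero,
      fun x y => LieSubmodule.lie_mem_lie (LieSubmodule.mem_top x) (LieSubmodule.mem_top y),
      hstem, fun P hP => ?_, fun a ha y => hTZ (hDZ a ha y), fun x hx => ?_⟩
    · rw [hD, LieSubmodule.lieIdeal_oper_eq_linear_span', Submodule.span_le]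
      rintro _ ⟨x, -, y, -, rfl⟩
      exact hP x y
    · have h1 := (hbreadth.2 (breadth F x)).2 ⟨x, rfl⟩
      rw [← breadth_eq_finrank_lieImage]
      simp only [List.mem_cons, List.not_mem_nil, or_false] at h1
      exact h1.resolve_left fun h0 => hx (mem_center_of_breadth_eq_zero h0)
  -- If all commutators were central, γ₃ would vanish.
  obtain ⟨x, y, hxy⟩ : ∃ x y : L, ⁅x, y⁆ ∉ (LieAlgebra.center F L).toSubmodule := by
    by_contra! hcon
    refine h2 ?_
    rw [hlcs, LieSubmodule.lie_eq_bot_iff]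
    intro t _ a ha
    exact H.derived_le _ hcon ha t
  have hZ := H.center_eq_lieImage hxy
  refine ⟨le_antisymm (fun z hz => ?_) hTZ, ?_⟩
  · have hz' : z ∈ (LieAlgebra.center F L).toSubmodule := hz
    rw [hZ] at hz'
    obtain ⟨t, -, rfl⟩ := mem_lieImage.1 hz'
    exact hDZ _ (H.lie_mem x y) t
  · rw [← H.finrank_lieImage _ hxy, ← hZ]
    rfl
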